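/- A $[p,n,k]$ complex orthogonal design (COD) is a $p\times n$ matrix $\mathcal O_z$ whose nonzero entries are among $\pm z_i,\pm z_i^*$, $1\le i\le k$ (where $z_1,\dots,z_k$ are complex indeterminates), such that $\mathcal O_z^H\mathcal O_z=(|z_1|^2+\cdots+|z_k|^2)I_n$. The equivalence operations are: row permutation; column permutation; conjugating all instances of one variable; negating all instances of one variable; renaming the variables (a permutation of their indices); multiplying a row by $-1$ (row negation); multiplying a column by $-1$ (column negation). Two designs are equivalent if one is obtained from the other by finitely many equivalence operations. Let $m\ge 1$. For $\alpha\in\mathbb F_2^{2m}$ write $\alpha(j)$ for its $j$-th bit, $\mathrm{wt}_{s,t}(\alpha)$ for the number of ones among bits $s,\dots,t$, and $\mathrm{wt}=\mathrm{wt}_{1,2m}$; let $e_i$ be the $i$-th unit vector and $e$ the all-one vector. The matrix $\mathcal G_{2m-1}$ has $\binom{2m}{m-1}$ rows, indexed by the $\alpha\in\mathbb F_2^{2m}$ with $\mathrm{wt}(\alpha)=m+1$; columns $i=1,\dots,2m-1$; and $\binom{2m-1}{m-1}$ variables $z_\gamma$, indexed by the $\gamma\in\mathbb F_2^{2m}$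 with $\mathrm{wt}(\gamma)=m$ and $\gamma(2m)=0$. Its entries are $$\mathcal G_{2m-1}(\alpha,i)=\begin{cases}(-1)^{\theta(\alpha,i)}z_{\alpha\oplus e_i}&\text{if }\alpha(i)=1,\ \alpha(2m)=0,\\(-1)^{\theta(\alpha,i)}z^*_{\alpha\oplus e_i\oplus e}&\text{if }\alpha(i)=1,\ \alpha(2m)=1,\\0&\text{if }\alpha(i)=0,\end{cases}$$ where $\theta(\alpha,i)=\mathrm{wt}_{i,2m}(\alpha)+\frac i2$ for even $i$ and $\theta(\alpha,i)=\mathrm{wt}_{i,2m}(\alpha)+\frac{i-1}2+\alpha(2m)$ for odd $i$. Rows and variables of $\mathcal G_{2m-1}$ are numbered in an arbitrary fixed order. Theorem. Every COD with parameters $\left[\binom{2m}{m-1},\,2m-1,\,\binom{2m-1}{m-1}\right]$ is equivalent to $\mathcal G_{2m-1}$ under the equivalence operations. Moreover, it can be transformed into $\mathcal G_{2m-1}$ by finitely many equivalence operations none of which is a column negation. -/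

import Mathlib

namespace COD

/-! ### Complex orthogonal designs -/

/-- A formal entry of a design in the variables `z_i`, `i : ι`: either `0`, or
`var s c i`, the variable `z_i`, negated if `s = true` and conjugated if `c = true`. -/
inductive Entry (ι : Type) : Type
  | zero : Entry ι
  | var (s c : Bool) (i : ι) : Entry ι

namespace Entry

/-- The complex number obtained by giving the variables the values `z`. -/
noncomputable def eval {ι : Type} (z : ι → ℂ) : Entry ι → ℂ
  | zero => 0
  | var s c i => (if s then -1 else 1) * (if c then star (z i) else z i)

/-- Negation of an entry. -/
def neg {ι : Type} : Entry ι → Entry ι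
  | zero => zero
  | var s c i => var (!s) c i

/-- Negate the entry if it is an instance of the variable `z_j`. -/
def negVar {ι : Type} [DecidableEq ι] (j : ι) : Entry ι → Entry ι
  | zero => zero
  | var s c i => if i = j then var (!s) c i else var s c i

/-- Conjugate the entry if it is an instance of the variable `z_j`. -/
def conjVar {ι : Type} [DecidableEq ι] (j : ι) : Entry ι → Entry ι
  | zero => zero
  | var s c i => if i = j then var s (!c) i else var s c i

/-- Change the index of the variable from `i` to `f i`. -/
def rename {ι κ : Type} (f : ι → κ) : Entry ι → Entry κ
  | zero => zero
  | var s c i => var s c (f i)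

end Entry

/-- A `p × n` matrix all of whose entries are `0`, `± z_i` or `± z_i^*`, `i = 1, …, k`. -/
abbrev Design (p n k : ℕ) : Type := Matrix (Fin p) (Fin n) (Entry (Fin k))

/-- The design `O` is a `[p, n, k]` complex orthogonal design:
`O^H O = (|z_1|^2 + ⋯ + |z_k|^2) I_n`, identically in the complex variables `z_1, …, z_k`. -/
def IsCOD {p n k : ℕ} (O : Design p n k) : Prop :=
  ∀ z : Fin k → ℂ,
    (O.map (Entry.eval z)).conjTranspose * O.map (Entry.eval z) =
      ((∑ i, ‖z i‖ ^ 2 : ℝ) : ℂ) • (1 : Matrix (Fin n) (Fin n) ℂ)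

/-! ### Equivalence operations -/

/-- The seven kinds of equivalence operations on `p × n` designs in `k` variables.
Renaming is by a permutation of the indices, so that distinct variables stay distinct. -/
inductive Op (p n k : ℕ) : Type
  | rowPermutation (σ : Equiv.Perm (Fin p)) : Op p n k
  | columnPermutation (τ : Equiv.Perm (Fin n)) : Op p n k
  | instanceConjugation (i : Fin k) : Op p n k
  | instanceNegation (i : Fin k) : Op p n k
  | instanceRenaming (ρ : Equiv.Perm (Fin k)) : Op p n k
  | rowNegation (r : Fin p) : Op p n k
  | columnNegation (c : Fin n) : Op p n k

/-- The result of performing an operation on a design. -/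
def Op.apply {p n k : ℕ} : Op p n k → Design p n k → Design p n k
  | rowPermutation σ, A => fun r c => A (σ r) c
  | columnPermutation τ, A => fun r c => A r (τ c)
  | instanceConjugation i, A => fun r c => (A r c).conjVar i
  | instanceNegation i, A => fun r c => (A r c).negVar i
  | instanceRenaming ρ, A => fun r c => (A r c).rename ρ
  | rowNegation r₀, A => fun r c => if r = r₀ then (A r c).neg else A r c
  | columnNegation c₀, A => fun r c => if c = c₀ then (A r c).neg else A r c

/-- `B` is obtained from `A` by finitely many operations, all taken from the set `S`. -/
def Transforms {p n k : ℕ} (S : Set (Op p n k)) (A B : Design p n k) : Prop :=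
  Relation.ReflTransGen (fun X Y => ∃ op ∈ S, Y = op.apply X) A B

/-- Two designs are the same under equivalence operations. -/
def Equivalent {p n k : ℕ} (A B : Design p n k) : Prop :=
  Transforms Set.univ A B

/-- All the operations other than column negations. -/
def withoutColumnNegation (p n k : ℕ) : Set (Op p n k) :=
  {op | ∀ c, op ≠ Op.columnNegation c}

/-! ### Binary vectors of length `2m`, with bits numbered from `1` to `2m` -/

/-- The space `𝔽₂^{2m}`. -/
abbrev BVec (m : ℕ) : Type := Fin (2 * m) → ZMod 2

/-- The `j`-th bit of `α`, for `1 ≤ j ≤ 2m` (and `0` for other `j`). -/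
def bit {m : ℕ} (α : BVec m) (j : ℕ) : ZMod 2 :=
  if h : 1 ≤ j ∧ j ≤ 2 * m then α ⟨j - 1, by omega⟩ else 0

/-- The vector `e_i` with `i`-th bit `1` and the others `0`. -/
def unitVec {m : ℕ} (i : ℕ) : BVec m := fun s => if (s : ℕ) + 1 = i then 1 else 0

/-- The all-one vector `e`. -/
def onesVec {m : ℕ} : BVec m := fun _ => 1

/-- `wt_{s,t}(α)`, the number of ones among the bits `s, …, t`. -/
def wtRange {m : ℕ} (s t : ℕ) (α : BVec m) : ℕ := ∑ j ∈ Finset.Icc s t, (bit α j).val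

/-- The weight of `α`, its number of ones. -/
def wt {m : ℕ} (α : BVec m) : ℕ := ∑ s, (α s).val

/-- The row indices of `𝒢_{2m-1}`: vectors of weight `m + 1`. -/
abbrev RowIdx (m : ℕ) : Type := {α : BVec m // wt α = m + 1}

/-- The variable indices of `𝒢_{2m-1}`: vectors of weight `m` with last bit `0`. -/
abbrev VarIdx (m : ℕ) : Type := {γ : BVec m // wt γ = m ∧ bit γ (2 * m) = 0}

/-- The exponent `θ(α, i)` of the sign. -/
def theta {m : ℕ} (α : BVec m) (i : ℕ) : ℕ :=
  if Even i then wtRange i (2 * m) α + i / 2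
  else wtRange i (2 * m) α + (i - 1) / 2 + (bit α (2 * m)).val

/-! ### Helper facts -/

theorem zmod2_cases (a : ZMod 2) : a = 0 ∨ a = 1 := by
  revert a; decide

theorem bit_add {m : ℕ} (α β : BVec m) (j : ℕ) : bit (α + β) j = bit α j + bit β j := by
  unfold bit; split <;> simp

theorem bit_succ {m : ℕ} (α : BVec m) (s : Fin (2 * m)) : bit α ((s : ℕ) + 1) = α s := by
  have := s.isLt
  unfold bit
  rw [dif_pos (by omega)]
  simp

theorem bit_unitVec_ne {m : ℕ} {i j : ℕ} (h : j ≠ i) : bit (unitVec i : BVec m) j = 0 := by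
  unfold bit unitVec
  split
  · rw [if_neg]; simp only; omega
  · rfl

theorem bit_onesVec {m : ℕ} {j : ℕ} (h1 : 1 ≤ j) (h2 : j ≤ 2 * m) :
    bit (onesVec : BVec m) j = 1 := by
  unfold bit onesVec
  rw [dif_pos ⟨h1, h2⟩]

theorem wt_add_unitVec {m : ℕ} (α : BVec m) (s : Fin (2 * m)) (h : α s = 1) :
    wt (α + unitVec ((s : ℕ) + 1)) + 1 = wt α := by
  unfold wt
  rw [← Finset.add_sum_erase _ _ (Finset.mem_univ s),
    ← Finset.add_sum_erase (a := s) Finset.univ (fun s => (α s).val) (Finset.mem_univ s)]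
  have h0 : ((α + unitVec ((s : ℕ) + 1) : BVec m) s).val = 0 := by
    simp only [Pi.add_apply, unitVec, h]
    simp only [if_true]
    decide
  have h1 : (α s).val = 1 := by rw [h]; decide
  have h2 : ∑ x ∈ Finset.univ.erase s, ((α + unitVec ((s : ℕ) + 1) : BVec m) x).val =
      ∑ x ∈ Finset.univ.erase s, (α x).val := by
    refine Finset.sum_congr rfl fun x hx => ?_
    have hne : ¬ ((x : ℕ) + 1 = (s : ℕ) + 1) := fun hh =>
      Finset.ne_of_mem_erase hx (Fin.ext (by omega))
    simp only [Pi.add_apply, unitVec]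
    rw [if_neg hne, add_zero]
  rw [h0, h1, h2]
  omega

theorem wt_add_onesVec {m : ℕ} (α : BVec m) : wt (α + onesVec) + wt α = 2 * m := by
  unfold wt
  rw [← Finset.sum_add_distrib]
  have : ∀ x : Fin (2 * m), ((α + onesVec : BVec m) x).val + (α x).val = 1 := by
    intro x
    simp only [Pi.add_apply, onesVec]
    generalize α x = a
    revert a; decide
  rw [Finset.sum_congr rfl fun x _ => this x]
  simp

theorem var_plain {m : ℕ} (α : RowIdx m) (c : Fin (2 * m - 1))
    (hi : bit α.1 ((c : ℕ) + 1) = 1) (hl : bit α.1 (2 * m) = 0) :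
    wt (α.1 + unitVec ((c : ℕ) + 1)) = m ∧
      bit (α.1 + unitVec ((c : ℕ) + 1)) (2 * m) = 0 := by
  have hc := c.isLt
  have hs := bit_succ α.1 ⟨c, by omega⟩
  have hw := wt_add_unitVec α.1 ⟨c, by omega⟩ (hs.symm.trans hi)
  have ha := α.2
  simp only at hw
  refine ⟨by omega, ?_⟩
  rw [bit_add, bit_unitVec_ne (by omega), hl, add_zero]

theorem var_conj {m : ℕ} (α : RowIdx m) (c : Fin (2 * m - 1))
    (hi : bit α.1 ((c : ℕ) + 1) = 1) (hl : ¬ bit α.1 (2 * m) = 0) :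
    wt (α.1 + unitVec ((c : ℕ) + 1) + onesVec) = m ∧
      bit (α.1 + unitVec ((c : ℕ) + 1) + onesVec) (2 * m) = 0 := by
  have hc := c.isLt
  have hs := bit_succ α.1 ⟨c, by omega⟩
  have hw := wt_add_unitVec α.1 ⟨c, by omega⟩ (hs.symm.trans hi)
  have ho := wt_add_onesVec (α.1 + unitVec ((c : ℕ) + 1))
  have ha := α.2
  simp only at hw
  refine ⟨by omega, ?_⟩
  rw [bit_add, bit_add, bit_unitVec_ne (by omega), bit_onesVec (by omega) le_rfl,
    (zmod2_cases _).resolve_left hl]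
  decide

/-! ### The explicit design -/

/-- The entries of `𝒢_{2m-1}`, with rows and variables indexed by binary vectors. The column
`c : Fin (2m - 1)` is the column number `i = c + 1`. -/
def explicitEntry (m : ℕ) (α : RowIdx m) (c : Fin (2 * m - 1)) : Entry (VarIdx m) :=
  if hi : bit α.1 ((c : ℕ) + 1) = 1 then
    if hl : bit α.1 (2 * m) = 0 then
      Entry.var (decide (Odd (theta α.1 ((c : ℕ) + 1)))) false
        ⟨α.1 + unitVec ((c : ℕ) + 1), var_plain α c hi hl⟩
    else
      Entry.var (decide (Odd (theta α.1 ((c : ℕ) + 1)))) true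
        ⟨α.1 + unitVec ((c : ℕ) + 1) + onesVec, var_conj α c hi hl⟩
  else Entry.zero

/-- Binary vectors as subsets. -/
def supportEquiv (m : ℕ) : BVec m ≃ Finset (Fin (2 * m)) where
  toFun α := Finset.univ.filter fun s => α s = 1
  invFun t := fun s => if s ∈ t then 1 else 0
  left_inv α := by
    funext s
    rcases zmod2_cases (α s) with h | h <;> simp [h]
  right_inv t := by
    ext s
    by_cases h : s ∈ t <;> simp [h]

theorem wt_eq_card {m : ℕ} (α : BVec m) : wt α = (supportEquiv m α).card := by
  simp only [wt, supportEquiv, Equiv.coe_fn_mk, Finset.card_filter]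
  refine Finset.sum_congr rfl fun s _ => ?_
  generalize α s = a
  revert a; decide

theorem card_rowIdx (m : ℕ) (hm : 1 ≤ m) :
    Fintype.card (RowIdx m) = (2 * m).choose (m - 1) := by
  have e : RowIdx m ≃ {t : Finset (Fin (2 * m)) // t.card = m + 1} :=
    (supportEquiv m).subtypeEquiv fun α => by rw [wt_eq_card]
  rw [Fintype.card_congr e, Fintype.card_finset_len, Fintype.card_fin]
  exact Nat.choose_symm_of_eq_add (by omega)

theorem card_varIdx (m : ℕ) (hm : 1 ≤ m) :
    Fintype.card (VarIdx m) = (2 * m - 1).choose (m - 1) := by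
  let l : Fin (2 * m) := ⟨2 * m - 1, by omega⟩
  have e : VarIdx m ≃
      {t : Finset (Fin (2 * m)) // t ∈ (Finset.univ.erase l).powersetCard m} :=
    (supportEquiv m).subtypeEquiv fun α => by
      have hb : bit α (2 * m) = α l := by
        unfold bit; rw [dif_pos (by omega)]
      rw [wt_eq_card, hb, Finset.mem_powersetCard, and_comm]
      refine and_congr_left fun _ => ?_
      rw [Finset.subset_erase]
      rcases zmod2_cases (α l) with h | h <;> simp [supportEquiv, h]
  rw [Fintype.card_congr e, Fintype.card_coe, Finset.card_powersetCard,
    Finset.card_erase_of_mem (Finset.mem_univ _), Finset.card_univ, Fintype.card_fin]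
  exact Nat.choose_symm_of_eq_add (by omega)

/-- A numbering of the rows of `𝒢_{2m-1}`. The choice is immaterial up to row permutation. -/
noncomputable def rowNumbering (m : ℕ) (hm : 1 ≤ m) :
    RowIdx m ≃ Fin ((2 * m).choose (m - 1)) :=
  Fintype.equivFinOfCardEq (card_rowIdx m hm)

/-- A numbering of the variables of `𝒢_{2m-1}`. The choice is immaterial up to renaming. -/
noncomputable def varNumbering (m : ℕ) (hm : 1 ≤ m) :
    VarIdx m ≃ Fin ((2 * m - 1).choose (m - 1)) :=
  Fintype.equivFinOfCardEq (card_varIdx m hm)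

/-- The explicit design `𝒢_{2m-1}`. -/
noncomputable def explicitDesign (m : ℕ) (hm : 1 ≤ m) :
    Design ((2 * m).choose (m - 1)) (2 * m - 1) ((2 * m - 1).choose (m - 1)) :=
  fun r c => (explicitEntry m ((rowNumbering m hm).symm r) c).rename (varNumbering m hm)

end COD

namespace COD

/-! Evaluating $\mathcal O^H\mathcal O$ at vectors with one or two nonzero coordinates shows that
each variable occurs exactly once in each column, and that two nonzero entries of a row complete to
a $2\times 2$ Alamouti block: the same two variables in the other row, opposite conjugations, and
product of signs $-1$ (`IsCOD.nonempty_pattern`).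

Hence a row containing $z_i$ in column $c$ meets, apart from $c$, only columns where $z_i$ is
conjugated differently than in $c$. Double counting the squared row weights against this bound, the
ratio of $p$ to $k$ leaves no slack: all inequalities are equalities (`Pattern.tight`). After
conjugating some variables, $z_i$ is conjugated exactly on an $m$-set of columns, its type, and the
type determines the supports of all rows containing $z_i$. Exchanges inside rows show that every
$m$-set is a type; as $k=\binom{2m-1}{m}$, types biject with variables and supports distinguish
rows. This fixes the design up to signs.

For the signs, place a variable at its type, a row of weight $m+1$ at its support and a row of
weight $m$ at the complement of its support. The nonzero entries become the edges between levels
$m-1,m,m+1$ of the cube, and the Alamouti blocks its squares there. The design and $\mathcal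
G_{2m-1}$ both have sign product $-1$ on each square (`theta_block`), so their ratio is a 1-cocycle,
hence a coboundary (`exists_potential`). The potential consists of row and variable negations; no
column negation is needed. -/

/-! ### The combinatorial pattern of a complex orthogonal design -/

/-- The positions, signs and conjugations of the variables in the columns of a design, together
with the constraints that orthogonality of the columns puts on them. -/
structure Pattern {p n k : ℕ} (O : Design p n k) where
  /-- The row in which the variable `i` occurs in column `c`. -/
  row : Fin n → Fin k → Fin p
  /-- Whether the variable `i` occurs negated in column `c`. -/
  neg : Fin n → Fin k → Bool
  /-- Whether the variable `i` occurs conjugated in column `c`. -/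
  cj : Fin n → Fin k → Bool
  entry : ∀ c i, O (row c i) c = Entry.var (neg c i) (cj c i) i
  eq_row : ∀ r c s b i, O r c = Entry.var s b i → r = row c i
  -- The Alamouti block spanned by columns `c`, `d` and variables `i`, `j`; the last clause says
  -- that its four signs multiply to $-1$.
  exchange : ∀ c d i j, c ≠ d → row c i = row d j →
    row c j = row d i ∧ cj c i ≠ cj d i ∧ cj c j ≠ cj d j ∧
      (neg c i ^^ neg d j ^^ neg c j ^^ neg d i) = true

theorem IsCOD.sum_eq {p n k : ℕ} {O : Design p n k} (hO : IsCOD O) (z : Fin k → ℂ)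
    (c d : Fin n) :
    ∑ r, star ((O r c).eval z) * (O r d).eval z =
      if c = d then ((∑ i, ‖z i‖ ^ 2 : ℝ) : ℂ) else 0 := by
  have h := congrFun (congrFun (hO z) c) d
  simpa [Matrix.mul_apply, Matrix.conjTranspose_apply, Matrix.one_apply] using h

theorem Entry.eval_single {k : ℕ} (i : Fin k) (a : Entry (Fin k))
    (h : ∀ s b, a ≠ Entry.var s b i) : a.eval (Pi.single i 1) = 0 := by
  cases a with
  | zero => rfl
  | var s b j =>
    have hj : j ≠ i := fun hj => h s b (by rw [hj])
    simp [Entry.eval, hj]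

theorem Entry.eval_single_self {k : ℕ} (i : Fin k) (s b : Bool) :
    (Entry.var s b i).eval (Pi.single i 1) = if s then -1 else 1 := by
  cases s <;> cases b <;> simp [Entry.eval]

/-- With $z_i=1$ and all other variables $0$, the squared norm of column `c` counts the occurrences
of $z_i$ in it, and it equals $1$. -/
theorem IsCOD.exists_unique_row {p n k : ℕ} {O : Design p n k} (hO : IsCOD O) (c : Fin n)
    (i : Fin k) : ∃! r, ∃ s b, O r c = Entry.var s b i := by
  classical
  have h := hO.sum_eq (Pi.single i 1) c c
  have h1 : ∀ r, star ((O r c).eval (Pi.single i 1)) * (O r c).eval (Pi.single i 1) =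
      if ∃ s b, O r c = Entry.var s b i then (1 : ℂ) else 0 := by
    intro r
    split_ifs with hr
    · obtain ⟨s, b, hr⟩ := hr
      rw [hr, Entry.eval_single_self]
      cases s <;> simp
    · push Not at hr
      rw [Entry.eval_single i _ hr, mul_zero]
  have h2 : ∑ j, ‖(Pi.single i 1 : Fin k → ℂ) j‖ ^ 2 = 1 := by
    rw [Finset.sum_eq_single i] <;> simp +contextual
  rw [Finset.sum_congr rfl fun r _ => h1 r, h2, if_pos rfl, Finset.sum_boole] at h
  have h3 : (Finset.univ.filter fun r => ∃ s b, O r c = Entry.var s b i).card = 1 := by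
    exact_mod_cast h
  obtain ⟨r, hr⟩ := Finset.card_eq_one.mp h3
  have h4 : ∀ r', (∃ s b, O r' c = Entry.var s b i) ↔ r' = r := fun r' => by
    have := Finset.ext_iff.mp hr r'
    simpa using this
  exact ⟨r, (h4 r).mpr rfl, fun r' hr' => (h4 r').mp hr'⟩

/-- Values `x`, `y` for two variables, all other variables being `0`. -/
def twoVal {k : ℕ} (i j : Fin k) (x y : ℂ) : Fin k → ℂ :=
  fun l => if l = i then x else if l = j then y else 0

theorem twoVal_left {k : ℕ} (i j : Fin k) (x y : ℂ) : twoVal i j x y i = x := by simp [twoVal]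

theorem twoVal_right {k : ℕ} {i j : Fin k} (h : i ≠ j) (x y : ℂ) : twoVal i j x y j = y := by
  simp [twoVal, h.symm]

theorem Entry.eval_twoVal {k : ℕ} (i j : Fin k) (x y : ℂ) (a : Entry (Fin k))
    (hi : ∀ s b, a ≠ Entry.var s b i) (hj : ∀ s b, a ≠ Entry.var s b j) :
    a.eval (twoVal i j x y) = 0 := by
  cases a with
  | zero => rfl
  | var s b l =>
    have h1 : l ≠ i := fun h => hi s b (by rw [h])
    have h2 : l ≠ j := fun h => hj s b (by rw [h])
    simp [Entry.eval, twoVal, h1, h2]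

/-- The pattern of a complex orthogonal design. -/
theorem IsCOD.nonempty_pattern {p n k : ℕ} {O : Design p n k} (hO : IsCOD O) :
    Nonempty (Pattern O) := by
  classical
  choose row hrow hrow' using fun c i => hO.exists_unique_row c i
  choose neg cj entry using hrow
  have eq_row : ∀ r c s b i, O r c = Entry.var s b i → r = row c i :=
    fun r c s b i h => hrow' c i r ⟨s, b, h⟩
  -- At the same evaluation, a common row would make the inner product of the two columns $\pm1$.
  have row_ne : ∀ c d i, c ≠ d → row c i ≠ row d i := by
    intro c d i hcd h
    have h0 := hO.sum_eq (Pi.single i 1) c d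
    rw [if_neg hcd, Finset.sum_eq_single (row c i)] at h0
    · rw [entry c i, h, entry d i, Entry.eval_single_self, Entry.eval_single_self] at h0
      revert h0
      cases neg c i <;> cases neg d i <;> simp
    · intro r _ hr
      rw [Entry.eval_single i (O r c) fun s b hs => hr (eq_row _ _ _ _ _ hs), star_zero, zero_mul]
    · simp
  have row_inj : ∀ c i j, row c i = row c j → i = j := by
    intro c i j h
    have h1 := entry c i
    rw [h, entry c j] at h1
    exact ((Entry.var.injEq ..).mp h1).2.2.symm
  have exchange : ∀ c d i j, c ≠ d → row c i = row d j →
      row c j = row d i ∧ cj c i ≠ cj d i ∧ cj c j ≠ cj d j ∧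
        (neg c i ^^ neg d j ^^ neg c j ^^ neg d i) = true := by
    intro c d i j hcd h
    have hij : i ≠ j := fun hij => row_ne c d i hcd (by rw [h, hij])
    have hne : row c i ≠ row c j := fun h => hij (row_inj c i j h)
    have key : ∀ x y : ℂ,
        star ((Entry.var (neg c i) (cj c i) i).eval (twoVal i j x y)) *
          (Entry.var (neg d j) (cj d j) j).eval (twoVal i j x y) +
        star ((Entry.var (neg c j) (cj c j) j).eval (twoVal i j x y)) *
          (O (row c j) d).eval (twoVal i j x y) = 0 := by
      intro x y
      have h0 := hO.sum_eq (twoVal i j x y) c d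
      rw [if_neg hcd, Finset.sum_eq_add (row c i) (row c j) hne] at h0
      · rwa [entry c i, entry c j, h, entry d j] at h0
      · rintro r _ ⟨h1, h2⟩
        rw [Entry.eval_twoVal i j x y (O r c) (fun s b hs => h1 (eq_row _ _ _ _ _ hs))
          (fun s b hs => h2 (eq_row _ _ _ _ _ hs)), star_zero, zero_mul]
      · simp
      · simp
    -- Otherwise only the row `row c i` contributes at $z_i=z_j=1$, and the inner product is $\pm1$
    -- instead of $0$.
    have hR : row c j = row d i := by
      by_contra hR
      have h0 := key 1 1
      rw [Entry.eval_twoVal i j 1 1 (O (row c j) d)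
        (fun s b hs => hR (eq_row _ _ _ _ _ hs))
        (fun s b hs => hne (h.trans (eq_row _ _ _ _ _ hs).symm)), mul_zero, add_zero] at h0
      revert h0
      simp only [Entry.eval, twoVal_left, twoVal_right hij]
      cases neg c i <;> cases neg d j <;> simp
    rw [hR, entry d i] at key
    simp only [Entry.eval, twoVal_left, twoVal_right hij] at key
    -- The values $(1,1)$ detect the signs, while $(\mathrm i,1)$ and $(1,\mathrm i)$ detect the
    -- conjugations of $z_i$ and $z_j$ respectively.
    have h1 := key 1 1
    have h2 := key Complex.I 1
    have h3 := key 1 Complex.I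
    have hI := Complex.I_ne_zero
    have hI2 : Complex.I + Complex.I ≠ 0 := by
      rw [← two_mul]; exact mul_ne_zero two_ne_zero hI
    have hI3 : -Complex.I + -Complex.I ≠ 0 := by
      rw [← neg_add]; exact neg_ne_zero.mpr hI2
    refine ⟨hR, ?_⟩
    clear key
    revert h1 h2 h3
    generalize neg c i = s1
    generalize neg d j = s2
    generalize neg c j = s3
    generalize neg d i = s4
    generalize cj c i = b1
    generalize cj d j = b2
    generalize cj c j = b3
    generalize cj d i = b4
    cases s1 <;> cases s2 <;> cases s3 <;> cases s4 <;> simp <;>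
      first
      | done
      | (cases b1 <;> cases b2 <;> cases b3 <;> cases b4 <;> simp [hI2, hI3])
  exact ⟨⟨row, neg, cj, entry, eq_row, exchange⟩⟩

/-! ### Row weights -/

open scoped Classical in
/-- The columns in which row `r` has a nonzero entry. -/
noncomputable def supp {p n k : ℕ} (O : Design p n k) (r : Fin p) : Finset (Fin n) :=
  Finset.univ.filter fun c => O r c ≠ Entry.zero

namespace Pattern

variable {p n k : ℕ} {O : Design p n k} (P : Pattern O)

theorem mem_supp {r : Fin p} {c : Fin n} : c ∈ supp O r ↔ ∃ i, r = P.row c i := by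
  simp only [supp, Finset.mem_filter, Finset.mem_univ, true_and]
  constructor
  · intro h
    rcases hrc : O r c with _ | ⟨s, b, i⟩
    · exact absurd hrc h
    · exact ⟨i, P.eq_row _ _ _ _ _ hrc⟩
  · rintro ⟨i, rfl⟩
    simp [P.entry]

theorem row_inj (c : Fin n) {i j : Fin k} (h : P.row c i = P.row c j) : i = j := by
  have h1 := P.entry c i
  rw [h, P.entry c j] at h1
  exact ((Entry.var.injEq ..).mp h1).2.2.symm

theorem row_mem_supp (c : Fin n) (i : Fin k) : c ∈ supp O (P.row c i) :=
  P.mem_supp.mpr ⟨i, rfl⟩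

/-- Nonzero entries in rows containing the variable `i` lie in columns where `i` is conjugated
differently. -/
theorem supp_subset (c : Fin n) (i : Fin k) :
    supp O (P.row c i) ⊆ insert c (Finset.univ.filter fun d => P.cj d i ≠ P.cj c i) := by
  intro d hd
  obtain ⟨j, hj⟩ := P.mem_supp.mp hd
  by_cases hcd : c = d
  · simp [hcd]
  · simpa using Or.inr (P.exchange c d i j hcd hj).2.1.symm

/-- Summation over the nonzero entries by rows and by variables. -/
theorem sum_supp (F : Fin p → Fin n → ℤ) :
    ∑ r, ∑ c ∈ supp O r, F r c = ∑ i, ∑ c, F (P.row c i) c := by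
  rw [Finset.sum_comm' (t' := Finset.univ) (s' := fun c => Finset.univ.filter (c ∈ supp O ·))
    (by simp)]
  rw [Finset.sum_comm]
  refine Finset.sum_congr rfl fun c _ => ?_
  rw [← Finset.sum_image (s := Finset.univ) (g := fun i => P.row c i) (f := fun r => F r c)
    fun i _ j _ h => P.row_inj c h]
  refine Finset.sum_congr ?_ fun _ _ => rfl
  ext r
  simp [P.mem_supp, eq_comm]

/-- The columns in which the variable `i` occurs conjugated. -/
def cols (i : Fin k) : Finset (Fin n) := Finset.univ.filter fun c => P.cj c i = true

theorem mem_cols {i : Fin k} {c : Fin n} : c ∈ P.cols i ↔ P.cj c i = true := by simp [cols]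

theorem filter_cj_ne (c : Fin n) (i : Fin k) :
    (Finset.univ.filter fun d => P.cj d i ≠ P.cj c i) =
      if c ∈ P.cols i then (P.cols i)ᶜ else P.cols i := by
  ext d
  split_ifs with h
  · rw [mem_cols] at h
    simp [mem_cols, h]
  · rw [mem_cols] at h
    simp [mem_cols, h]

theorem card_bound (c : Fin n) (i : Fin k) :
    (insert c (Finset.univ.filter fun d => P.cj d i ≠ P.cj c i)).card =
      if c ∈ P.cols i then n - (P.cols i).card + 1 else (P.cols i).card + 1 := by
  rw [Finset.card_insert_of_notMem (by simp), filter_cj_ne]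
  split_ifs <;> simp [Finset.card_compl]

theorem sum_card_bound (i : Fin k) :
    ∑ c, ((insert c (Finset.univ.filter fun d => P.cj d i ≠ P.cj c i)).card : ℤ) =
      n + 2 * (P.cols i).card * (n - (P.cols i).card) := by
  have hle : (P.cols i).card ≤ n := by simpa using Finset.card_le_univ (P.cols i)
  have h1 : ∀ c, ((insert c (Finset.univ.filter fun d => P.cj d i ≠ P.cj c i)).card : ℤ) =
      if c ∈ P.cols i then (n : ℤ) - (P.cols i).card + 1 else (P.cols i).card + 1 := by
    intro c
    rw [card_bound]
    split_ifs <;> push_cast [hle] <;> rfl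
  have h2 : (Finset.univ.filter fun c => c ∉ P.cols i).card = n - (P.cols i).card := by
    have : (Finset.univ.filter fun c => c ∉ P.cols i) = (P.cols i)ᶜ := by ext; simp
    rw [this, Finset.card_compl, Fintype.card_fin]
  rw [Finset.sum_congr rfl fun c _ => h1 c, Finset.sum_ite, Finset.sum_const, Finset.sum_const, h2]
  have h3 : (Finset.univ.filter fun c => c ∈ P.cols i) = P.cols i := by ext; simp
  rw [h3]
  simp only [nsmul_eq_mul]
  push_cast [hle]
  ring

end Pattern

theorem consecutive_nonneg (w m : ℤ) : 0 ≤ (w - m) * (w - m - 1) := by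
  rcases le_or_gt w m with h | h
  · exact mul_nonneg_of_nonpos_of_nonpos (by omega) (by omega)
  · exact mul_nonneg (by omega) (by omega)

/-- If the rate is `(m + 1) / (2 m)`, then all rows have `m` or `m + 1` nonzero entries, each
variable is conjugated in `m - 1` or `m` columns, and the rows of each variable are full. -/
theorem Pattern.tight {p k m : ℕ} (hm : 1 ≤ m) {O : Design p (2 * m - 1) k} (P : Pattern O)
    (hp : (m + 1) * p = 2 * m * k) :
    (∀ i, (P.cols i).card = m ∨ (P.cols i).card + 1 = m) ∧
      (∀ c i, supp O (P.row c i) =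
        insert c (Finset.univ.filter fun d => P.cj d i ≠ P.cj c i)) ∧
      ∀ r, (supp O r).card = m ∨ (supp O r).card = m + 1 := by
  set B : Fin (2 * m - 1) → Fin k → ℤ :=
    fun c i => ((insert c (Finset.univ.filter fun d => P.cj d i ≠ P.cj c i)).card : ℤ)
  set w : Fin p → ℤ := fun r => ((supp O r).card : ℤ)
  have hn : ((2 * m - 1 : ℕ) : ℤ) = 2 * m - 1 := by omega
  set t : Fin k → ℤ := fun i => ((P.cols i).card : ℤ)
  have hp' : ((m : ℤ) + 1) * p = 2 * m * k := by exact_mod_cast hp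
  have hsq : ∑ r, w r * w r = ∑ i, ∑ c, w (P.row c i) := by
    rw [← P.sum_supp fun r _ => w r]
    simp [w]
  have hlin : ∑ r, w r = (2 * m - 1) * k := by
    have := P.sum_supp fun _ _ => 1
    simp only [Finset.sum_const, Finset.card_univ, Fintype.card_fin, nsmul_eq_mul, mul_one] at this
    simp only [w]
    rw [this, hn]; ring
  have hB : ∀ i, ∑ c, B c i = 2 * m ^ 2 - 1 - 2 * ((t i - (m - 1)) * (t i - (m - 1) - 1)) := by
    intro i
    rw [P.sum_card_bound, hn]
    simp only [t]; ring
  have hwB : ∀ c i, 0 ≤ B c i - w (P.row c i) := fun c i => by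
    have := Finset.card_le_card (P.supp_subset c i)
    simp only [B, w]
    omega
  -- Each quadratic is nonnegative on integers and vanishes only at two consecutive ones: the
  -- permitted row weights, and the maximizers $m-1$, $m$ of $t(2m-1-t)$. The middle sum is the
  -- slack in `supp_subset`. By the rate hypothesis the constants cancel, so every term is zero.
  have h0 : ∑ r, (w r - m) * (w r - m - 1) +
      (∑ i, ∑ c, (B c i - w (P.row c i)) +
        ∑ i, 2 * ((t i - (m - 1)) * (t i - (m - 1) - 1))) = 0 := by
    have e1 : ∑ r, (w r - m) * (w r - m - 1) =
        ∑ r, w r * w r - (2 * m + 1) * ∑ r, w r + m * ((m + 1) * p) := by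
      have : ∀ r, (w r - m) * (w r - m - 1) = w r * w r - (2 * m + 1) * w r + m * (m + 1) :=
        fun r => by ring
      rw [Finset.sum_congr rfl fun r _ => this r, Finset.sum_add_distrib, Finset.sum_sub_distrib,
        ← Finset.mul_sum]
      simp; ring
    simp only [Finset.sum_sub_distrib]
    rw [e1, hsq, hlin, hp', Finset.sum_congr rfl fun i _ => hB i, Finset.sum_sub_distrib]
    simp; ring
  have n1 : ∀ r ∈ Finset.univ, 0 ≤ (w r - m) * (w r - m - 1) :=
    fun r _ => consecutive_nonneg _ _
  have n3 : ∀ i ∈ Finset.univ, 0 ≤ 2 * ((t i - (m - 1)) * (t i - (m - 1) - 1)) :=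
    fun i _ => mul_nonneg zero_le_two (consecutive_nonneg _ _)
  have n2 : ∀ i ∈ Finset.univ, 0 ≤ ∑ c, (B c i - w (P.row c i)) :=
    fun i _ => Finset.sum_nonneg fun c _ => hwB c i
  have s1 := Finset.sum_nonneg n1
  have s2 := Finset.sum_nonneg n2
  have s3 := Finset.sum_nonneg n3
  have z1 := (Finset.sum_eq_zero_iff_of_nonneg n1).mp (by linarith)
  have z2 := (Finset.sum_eq_zero_iff_of_nonneg n2).mp (by linarith)
  have z3 := (Finset.sum_eq_zero_iff_of_nonneg n3).mp (by linarith)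
  refine ⟨fun i => ?_, fun c i => ?_, fun r => ?_⟩
  · have h := z3 i (Finset.mem_univ _)
    rcases mul_eq_zero.mp ((mul_eq_zero.mp h).resolve_left two_ne_zero) with h | h <;>
      simp only [t] at h <;> omega
  · refine Finset.eq_of_subset_of_card_le (P.supp_subset c i) ?_
    have h := (Finset.sum_eq_zero_iff_of_nonneg fun c _ => hwB c i).mp (z2 i (Finset.mem_univ _))
      c (Finset.mem_univ _)
    simp only [B, w] at h
    omega
  · rcases mul_eq_zero.mp (z1 r (Finset.mem_univ _)) with h | h <;> simp only [w] at h <;> omega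

/-! ### Subsets of fixed size -/

/-- A property of subsets of `U` that is kept when one element is exchanged for another holds for
all subsets of a given size if it holds for one of them. -/
theorem exchange_induction {ι : Type} [DecidableEq ι] (U : Finset ι) (P : Finset ι → Prop)
    (step : ∀ S, S ⊆ U → P S → ∀ x ∈ U, x ∉ S → ∀ y ∈ S, P ((insert x S).erase y))
    {S T : Finset ι} (hS : S ⊆ U) (hT : T ⊆ U) (hc : S.card = T.card) (h : P S) : P T := by
  induction hn : (T \ S).card generalizing S with
  | zero =>
    have hTS : T ⊆ S := Finset.sdiff_eq_empty_iff_subset.mp (Finset.card_eq_zero.mp hn)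
    rwa [Finset.eq_of_subset_of_card_le hTS hc.le]
  | succ q ih =>
    have h1 : (S \ T).card = q + 1 := by
      rw [← hn]; exact Finset.card_sdiff_comm hc
    obtain ⟨x, hx⟩ := Finset.card_pos.mp (by omega : 0 < (T \ S).card)
    obtain ⟨y, hy⟩ := Finset.card_pos.mp (by omega : 0 < (S \ T).card)
    rw [Finset.mem_sdiff] at hx hy
    have hyx : y ∈ insert x S := Finset.mem_insert_of_mem hy.1
    refine ih (S := (insert x S).erase y) ?_ ?_ (step S hS h x (hT hx.1) hx.2 y hy.1) ?_
    · exact (Finset.erase_subset _ _).trans (Finset.insert_subset (hT hx.1) hS)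
    · rw [Finset.card_erase_of_mem hyx, Finset.card_insert_of_notMem hx.2]
      omega
    · have h2 : T \ (insert x S).erase y = (T \ S).erase x := by
        ext w
        simp only [Finset.mem_sdiff, Finset.mem_erase, Finset.mem_insert]
        by_cases hw : w = y
        · subst hw; simp [hy.2]
        · tauto
      rw [h2, Finset.card_erase_of_mem (Finset.mem_sdiff.mpr hx), hn]
      rfl

/-- A function on two consecutive levels of the cube that is constant along edges is constant. -/
theorem const_of_edges {ι A : Type} [DecidableEq ι] (U : Finset ι) (a : ℤ) (g : Finset ι → A)
    (hg : ∀ S ⊆ U, (S.card : ℤ) = a - 1 → ∀ x ∈ U, x ∉ S → g S = g (insert x S)) :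
    ∃ v, ∀ S ⊆ U, ((S.card : ℤ) = a - 1 ∨ (S.card : ℤ) = a) → g S = v := by
  by_cases hex : ∃ S ⊆ U, (S.card : ℤ) = a - 1
  · obtain ⟨S₀, h0, hc0⟩ := hex
    have low : ∀ S ⊆ U, (S.card : ℤ) = a - 1 → g S = g S₀ := by
      intro S hS hc
      refine (exchange_induction U (fun T => (T.card : ℤ) = a - 1 ∧ g T = g S₀) ?_ h0 hS
        (by omega) ⟨hc0, rfl⟩).2
      rintro T hT ⟨hTc, hTg⟩ x hx hxT y hy
      have hyx : y ∈ insert x T := Finset.mem_insert_of_mem hy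
      have hcard : (((insert x T).erase y).card : ℤ) = a - 1 := by
        rw [Finset.card_erase_of_mem hyx, Finset.card_insert_of_notMem hxT]
        simpa using hTc
      refine ⟨hcard, ?_⟩
      have hsub : (insert x T).erase y ⊆ U :=
        (Finset.erase_subset _ _).trans (Finset.insert_subset hx hT)
      -- The exchanged set and `T` have the common upper neighbour `insert x T`.
      rw [hg _ hsub hcard y (hT hy) (Finset.notMem_erase _ _), Finset.insert_erase hyx,
        ← hg T hT hTc x hx hxT, hTg]
    refine ⟨g S₀, fun S hS hc => hc.elim (low S hS) fun hc => ?_⟩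
    obtain ⟨x, hx⟩ : S.Nonempty := Finset.card_pos.mp (by omega)
    have hsub : S.erase x ⊆ U := (Finset.erase_subset _ _).trans hS
    have hcard : ((S.erase x).card : ℤ) = a - 1 := by
      have := Finset.card_erase_add_one hx
      omega
    rw [← low _ hsub hcard, hg _ hsub hcard x (hS hx) (Finset.notMem_erase _ _),
      Finset.insert_erase hx]
  -- If level `a - 1` is empty, then level `a` contains at most the empty set.
  · push Not at hex
    refine ⟨g ∅, fun S hS hc => ?_⟩
    rcases hc with hc | hc
    · exact absurd hc (hex S hS)
    · rcases S.eq_empty_or_nonempty with rfl | ⟨x, hx⟩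
      · rfl
      · have := Finset.card_erase_add_one hx
        exact absurd (by omega) (hex (S.erase x) ((Finset.erase_subset _ _).trans hS))

/-- A function on the edges between three consecutive levels of the cube that is closed on the
squares spanned by these levels is a coboundary. -/
theorem exists_potential {ι A : Type} [DecidableEq ι] [AddCommGroup A] (U : Finset ι) :
    ∀ (a : ℤ) (δ : Finset ι → ι → A),
      (∀ S ⊆ U, (S.card : ℤ) = a - 1 → ∀ x ∈ U, x ∉ S → ∀ y ∈ U, y ∉ S → x ≠ y →
        δ S x + δ (insert x S) y = δ S y + δ (insert y S) x) →
      ∃ f : Finset ι → A, ∀ S ⊆ U, ((S.card : ℤ) = a - 1 ∨ (S.card : ℤ) = a) →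
        ∀ x ∈ U, x ∉ S → f (insert x S) = f S + δ S x := by
  induction U using Finset.induction_on with
  | empty => intro a δ _; exact ⟨0, by simp⟩
  | insert u U hu ih =>
    intro a δ hδ
    have hUi : ∀ {S}, S ⊆ U → S ⊆ insert u U := fun h => h.trans (Finset.subset_insert _ _)
    have hiU : ∀ {S}, S ⊆ U → insert u S ⊆ insert u U := fun h => Finset.insert_subset_insert _ h
    have huS : ∀ {S}, S ⊆ U → u ∉ S := fun h hS => hu (h hS)
    have hcu : ∀ {S}, S ⊆ U → ((insert u S).card : ℤ) = S.card + 1 := fun h => by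
      rw [Finset.card_insert_of_notMem (huS h)]; push_cast; ring
    have hne : ∀ {x}, x ∈ U → x ≠ u := fun h hx => hu (hx ▸ h)
    obtain ⟨f₀, h₀⟩ := ih a δ fun S hS hc x hx hxS y hy hyS hxy =>
      hδ S (hUi hS) hc x (Finset.mem_insert_of_mem hx) hxS y (Finset.mem_insert_of_mem hy) hyS hxy
    -- The sets containing `u` form a smaller cube with all levels shifted down by one. Repeated
    -- shifts may make `a` negative, hence integer levels.
    obtain ⟨f₁, h₁⟩ := ih (a - 1) (fun S x => δ (insert u S) x)
        fun S hS hc x hx hxS y hy hyS hxy => by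
      have := hδ (insert u S) (hiU hS) (by rw [hcu hS]; omega) x (Finset.mem_insert_of_mem hx)
        (by simp [hne hx, hxS]) y (Finset.mem_insert_of_mem hy) (by simp [hne hy, hyS]) hxy
      rwa [Finset.insert_comm x, Finset.insert_comm y] at this
    -- The mismatch of the two potentials along direction `u` is constant by the squares containing
    -- that direction, so subtracting it from `f₁` glues them.
    obtain ⟨v, hv⟩ := const_of_edges U a (fun S => f₁ S - f₀ S - δ S u) fun S hS hc x hx hxS => by
      have e0 := h₀ S hS (Or.inl hc) x hx hxS
      have e1 := h₁ S hS (Or.inr hc) x hx hxS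
      have e2 := hδ S (hUi hS) hc x (Finset.mem_insert_of_mem hx) hxS u
        (Finset.mem_insert_self _ _) (huS hS) (hne hx)
      rw [e0, e1, ← sub_eq_zero]
      rw [← sub_eq_zero] at e2
      rw [← e2]
      abel
    refine ⟨fun S => if u ∈ S then f₁ (S.erase u) - v else f₀ S, fun S hS hc x hx hxS => ?_⟩
    by_cases huS' : u ∈ S
    · have hxu : x ≠ u := fun h => hxS (h ▸ huS')
      have hxU : x ∈ U := (Finset.mem_insert.mp hx).resolve_left hxu
      have hsub : S.erase u ⊆ U := by
        rw [Finset.subset_insert_iff] at hS; exact hS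
      have hcard := Finset.card_erase_add_one huS'
      simp only [huS', Finset.mem_insert_of_mem, if_true]
      rw [Finset.erase_insert_of_ne hxu,
        h₁ _ hsub (by omega) x hxU (by simp [hxS]), Finset.insert_erase huS']
      abel
    · have hsub : S ⊆ U := by
        rw [Finset.subset_insert_iff, Finset.erase_eq_of_notMem huS'] at hS; exact hS
      by_cases hxu : x = u
      · subst hxu
        simp only [huS', Finset.mem_insert_self, if_true, if_false, Finset.erase_insert_eq_erase,
          Finset.erase_eq_of_notMem huS']
        rw [← hv S hsub hc]
        abel
      · have hxU : x ∈ U := (Finset.mem_insert.mp hx).resolve_left hxu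
        have : u ∉ insert x S := by simp [huS', Ne.symm hxu]
        simp only [this, huS', if_false]
        exact h₀ S hsub hc x hxU hxS

namespace Pattern

variable {p k m : ℕ} {O : Design p (2 * m - 1) k} (P : Pattern O)

/-! ### The type of a variable -/

/-- The `m`-element set of the columns where the variable `i` is conjugated once it has been
normalized. -/
def type (i : Fin k) : Finset (Fin (2 * m - 1)) :=
  if (P.cols i).card = m then P.cols i else (P.cols i)ᶜ

/-- Whether the variable `i` has to be conjugated to be normalized. -/
def flip (i : Fin k) : Bool := decide ((P.cols i).card ≠ m)

theorem mem_type {i : Fin k} {c : Fin (2 * m - 1)} :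
    c ∈ P.type i ↔ (P.cj c i ^^ P.flip i) = true := by
  unfold type flip
  split_ifs with h <;> simp [h, mem_cols]

theorem card_type (hm : 1 ≤ m) (hp : (m + 1) * p = 2 * m * k) (i : Fin k) :
    (P.type i).card = m := by
  unfold type
  split_ifs with h
  · exact h
  · rw [Finset.card_compl, Fintype.card_fin]
    have := (P.tight hm hp).1 i
    omega

/-- Complementing the set of conjugated columns does not change which pairs of columns conjugate `i`
differently, so the full supports from `tight` can be expressed by the type. -/
theorem supp_row (hm : 1 ≤ m) (hp : (m + 1) * p = 2 * m * k) (c : Fin (2 * m - 1)) (i : Fin k) :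
    supp O (P.row c i) = insert c (if c ∈ P.type i then (P.type i)ᶜ else P.type i) := by
  rw [(P.tight hm hp).2.1 c i]
  congr 1
  ext d
  split_ifs with h
  · rw [mem_type] at h
    simp only [Finset.mem_filter, Finset.mem_univ, true_and, Finset.mem_compl, mem_type]
    revert h
    cases P.cj c i <;> cases P.cj d i <;> cases P.flip i <;> simp
  · rw [mem_type] at h
    simp only [Finset.mem_filter, Finset.mem_univ, true_and, mem_type]
    revert h
    cases P.cj c i <;> cases P.cj d i <;> cases P.flip i <;> simp

theorem card_supp_row (hm : 1 ≤ m) (hp : (m + 1) * p = 2 * m * k) (c : Fin (2 * m - 1))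
    (i : Fin k) : (supp O (P.row c i)).card = if c ∈ P.type i then m else m + 1 := by
  rw [P.supp_row hm hp]
  split_ifs with h
  · rw [Finset.card_insert_of_notMem (by simpa using h), Finset.card_compl, Fintype.card_fin,
      P.card_type hm hp]
    omega
  · rw [Finset.card_insert_of_notMem h, P.card_type hm hp]

theorem mem_type_iff_card (hm : 1 ≤ m) (hp : (m + 1) * p = 2 * m * k) (c : Fin (2 * m - 1))
    (i : Fin k) : c ∈ P.type i ↔ (supp O (P.row c i)).card = m := by
  rw [P.card_supp_row hm hp]
  split_ifs with h <;> simp [h]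

/-- The type of a variable is determined by the support of any of its rows. -/
theorem type_eq (hm : 1 ≤ m) (hp : (m + 1) * p = 2 * m * k) (c : Fin (2 * m - 1)) (i : Fin k) :
    P.type i = if (supp O (P.row c i)).card = m then insert c (supp O (P.row c i))ᶜ
      else (supp O (P.row c i)).erase c := by
  have hc := P.mem_type_iff_card hm hp c i
  by_cases h : c ∈ P.type i
  · rw [if_pos (hc.mp h), P.supp_row hm hp, if_pos h]
    simp [h]
  · rw [if_neg (mt hc.mpr h), P.supp_row hm hp, if_neg h, Finset.erase_insert h]

/-- If `x` is outside the type of `i` and `y` inside, the row of `i` in column `x` has a nonzero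
entry in column `y`. Its variable has the type obtained by exchanging `y` for `x`, and such
exchanges connect all `m`-sets. -/
theorem exists_type_eq (hm : 1 ≤ m) (hp : (m + 1) * p = 2 * m * k) (hk : 0 < k)
    {S : Finset (Fin (2 * m - 1))} (hS : S.card = m) : ∃ i, P.type i = S := by
  refine exchange_induction Finset.univ (fun T => ∃ i, P.type i = T) ?_
    (Finset.subset_univ (P.type ⟨0, hk⟩)) (Finset.subset_univ S)
    ((P.card_type hm hp _).trans hS.symm) ⟨_, rfl⟩
  rintro _ - ⟨i, rfl⟩ x - hx y hy
  have hs := P.supp_row hm hp x i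
  have hc := P.card_supp_row hm hp x i
  rw [if_neg hx] at hs hc
  have hys : y ∈ supp O (P.row x i) := by rw [hs]; exact Finset.mem_insert_of_mem hy
  obtain ⟨j, hj⟩ := P.mem_supp.mp hys
  refine ⟨j, ?_⟩
  rw [P.type_eq hm hp y j, ← hj, hc, if_neg (by omega), hs]

theorem type_injective (hm : 1 ≤ m) (hp : (m + 1) * p = 2 * m * k)
    (hk : k = (2 * m - 1).choose m) : Function.Injective P.type := by
  have hk0 : 0 < k := by rw [hk]; exact Nat.choose_pos (by omega)
  let g : Fin k → {S : Finset (Fin (2 * m - 1)) // S.card = m} :=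
    fun i => ⟨P.type i, P.card_type hm hp i⟩
  have hg : Function.Surjective g := fun S => by
    obtain ⟨i, hi⟩ := P.exists_type_eq hm hp hk0 S.2
    exact ⟨i, Subtype.ext hi⟩
  have hb := (Fintype.bijective_iff_surjective_and_card g).mpr
    ⟨hg, by rw [Fintype.card_finset_len, Fintype.card_fin, Fintype.card_fin, hk]⟩
  exact fun i j h => hb.1 (Subtype.ext h)

theorem supp_injective (P : Pattern O) (hm : 1 ≤ m) (hp : (m + 1) * p = 2 * m * k)
    (hk : k = (2 * m - 1).choose m) : Function.Injective (supp O) := by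
  intro r r' h
  have h1 := (P.tight hm hp).2.2 r
  obtain ⟨c, hc⟩ : (supp O r).Nonempty := Finset.card_pos.mp (by omega)
  obtain ⟨i, rfl⟩ := P.mem_supp.mp hc
  rw [h] at hc
  obtain ⟨j, rfl⟩ := P.mem_supp.mp hc
  have : P.type i = P.type j := by rw [P.type_eq hm hp c i, P.type_eq hm hp c j, h]
  rw [P.type_injective hm hp hk this]

/-! ### Signs -/

/-- Signs attached to the nonzero entries whose product over every Alamouti block is trivial can be
distributed to the rows and the variables. -/
theorem exists_sign_split (hm : 1 ≤ m) (hp : (m + 1) * p = 2 * m * k)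
    (hk : k = (2 * m - 1).choose m) (δ : Fin (2 * m - 1) → Fin k → ZMod 2)
    (hδ : ∀ x y i j S, x ≠ y → x ∉ S → y ∉ S → P.type i = insert x S → P.type j = insert y S →
      P.row x i = P.row y j → P.row x j = P.row y i → δ x i + δ y i = δ y j + δ x j) :
    ∃ (μ : Fin p → ZMod 2) (ν : Fin k → ZMod 2), ∀ c i, δ c i = ν i + μ (P.row c i) := by
  have hk0 : 0 < k := by rw [hk]; exact Nat.choose_pos (by omega)
  have hv : ∀ S : Finset (Fin (2 * m - 1)), ∃ i, S.card = m → P.type i = S := fun S => by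
    by_cases h : S.card = m
    · obtain ⟨i, hi⟩ := P.exists_type_eq hm hp hk0 h
      exact ⟨i, fun _ => hi⟩
    · exact ⟨⟨0, hk0⟩, fun h' => absurd h' h⟩
  choose v hv using hv
  have hvt : ∀ i, v (P.type i) = i := fun i =>
    P.type_injective hm hp hk (hv _ (P.card_type hm hp i))
  obtain ⟨f, hf⟩ := exists_potential (Finset.univ : Finset (Fin (2 * m - 1))) (m : ℤ)
    -- The edge from `S` to `insert x S` is the entry in column `x` of the variable whose type is
    -- the endpoint of size `m`.
    (fun S x => if S.card = m then δ x (v S) else δ x (v (insert x S))) (by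
      intro S _ hc x _ hx y _ hy hxy
      have hcx : (insert x S).card = m := by rw [Finset.card_insert_of_notMem hx]; omega
      have hcy : (insert y S).card = m := by rw [Finset.card_insert_of_notMem hy]; omega
      have hcS : S.card ≠ m := by omega
      simp only [if_neg hcS, if_pos hcx, if_pos hcy]
      have tx := hv _ hcx
      have ty := hv _ hcy
      set i := v (insert x S)
      set j := v (insert y S)
      refine hδ x y i j S hxy hx hy tx ty ?_ ?_
      · refine P.supp_injective hm hp hk ?_
        rw [P.supp_row hm hp, P.supp_row hm hp, tx, ty]
        ext d
        by_cases h1 : d = x <;> by_cases h2 : d = y <;> simp_all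
      · refine P.supp_injective hm hp hk ?_
        rw [P.supp_row hm hp, P.supp_row hm hp, tx, ty]
        simp [hxy, hxy.symm, hx, hy, Finset.insert_comm])
  refine ⟨fun r => f (if (supp O r).card = m then (supp O r)ᶜ else supp O r),
    fun i => f (P.type i), fun c i => ?_⟩
  have hct := P.card_type hm hp i
  simp only [← P.mem_type_iff_card hm hp]
  rw [P.supp_row hm hp]
  by_cases h : c ∈ P.type i
  · have hcard := Finset.card_erase_add_one h
    have := hf ((P.type i).erase c) (Finset.subset_univ _) (Or.inl (by omega)) c
      (Finset.mem_univ _) (Finset.notMem_erase _ _)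
    rw [if_neg (by omega), Finset.insert_erase h, hvt] at this
    rw [if_pos h, if_pos h, Finset.compl_insert, compl_compl, this, add_comm (f _) (δ c i),
      add_assoc, CharTwo.add_self_eq_zero, add_zero]
  · have := hf (P.type i) (Finset.subset_univ _) (Or.inr (by omega)) c (Finset.mem_univ _) h
    rw [if_pos hct, hvt] at this
    rw [if_neg h, if_neg h, this, ← add_assoc, CharTwo.add_self_eq_zero, zero_add]

end Pattern

/-! ### Binary vectors with a prescribed last bit -/

theorem wt_eq_sum_bit {m : ℕ} (hm : 1 ≤ m) (α : BVec m) :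
    wt α = ∑ c : Fin (2 * m - 1), (bit α ((c : ℕ) + 1)).val + (bit α (2 * m)).val := by
  have h : wt α = ∑ j ∈ Finset.range (2 * m), (bit α (j + 1)).val := by
    rw [Finset.sum_range]
    exact Finset.sum_congr rfl fun s _ => by rw [bit_succ]
  rw [h, ← Fin.sum_univ_eq_sum_range (fun j => (bit α (j + 1)).val),
    Fin.sum_univ_eq_sum_range (fun j => (bit α (j + 1)).val),
    Fin.sum_univ_eq_sum_range (fun j => (bit α (j + 1)).val)]
  obtain ⟨q, hq⟩ : ∃ q, 2 * m = q + 1 := ⟨2 * m - 1, by omega⟩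
  have h1 : 2 * m - 1 = q := by omega
  rw [h1, hq, Finset.sum_range_succ]

theorem bvec_ext {m : ℕ} {α β : BVec m}
    (h : ∀ c : Fin (2 * m - 1), bit α ((c : ℕ) + 1) = bit β ((c : ℕ) + 1))
    (hl : bit α (2 * m) = bit β (2 * m)) : α = β := by
  funext s
  rw [← bit_succ α s, ← bit_succ β s]
  by_cases hs : (s : ℕ) < 2 * m - 1
  · exact h ⟨s, hs⟩
  · have : (s : ℕ) + 1 = 2 * m := by omega
    rw [this, hl]

/-- The vector with last bit `b` whose other ones are at the positions in `S`. -/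
def toBVec {m : ℕ} (S : Finset (Fin (2 * m - 1))) (b : ZMod 2) : BVec m :=
  fun s => if h : (s : ℕ) < 2 * m - 1 then if ⟨s, h⟩ ∈ S then 1 else 0 else b

theorem bit_toBVec {m : ℕ} (S : Finset (Fin (2 * m - 1))) (b : ZMod 2) (c : Fin (2 * m - 1)) :
    bit (toBVec S b) ((c : ℕ) + 1) = if c ∈ S then 1 else 0 := by
  have := c.isLt
  rw [bit_succ (toBVec S b) ⟨c, by omega⟩]
  simp [toBVec]

theorem bit_toBVec_last {m : ℕ} (hm : 1 ≤ m) (S : Finset (Fin (2 * m - 1))) (b : ZMod 2) :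
    bit (toBVec S b) (2 * m) = b := by
  unfold bit toBVec
  rw [dif_pos (by omega), dif_neg (by simp)]

theorem wt_toBVec {m : ℕ} (hm : 1 ≤ m) (S : Finset (Fin (2 * m - 1))) (b : ZMod 2) :
    wt (toBVec S b) = S.card + b.val := by
  rw [wt_eq_sum_bit hm, bit_toBVec_last hm]
  congr 1
  have h : ∀ c : Fin (2 * m - 1), (bit (toBVec S b) ((c : ℕ) + 1)).val = if c ∈ S then 1 else 0 :=
    fun c => by rw [bit_toBVec]; split_ifs <;> rfl
  simp [h]

theorem toBVec_injective {m : ℕ} {S T : Finset (Fin (2 * m - 1))} {a b : ZMod 2}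
    (h : toBVec S a = toBVec T b) : S = T := by
  ext c
  have := congrArg (bit · ((c : ℕ) + 1)) h
  simp only [bit_toBVec] at this
  by_cases h1 : c ∈ S <;> by_cases h2 : c ∈ T <;> simp_all

/-! ### The signs of the explicit design -/

theorem cast_wtRange {m : ℕ} (s t : ℕ) (α : BVec m) :
    (wtRange s t α : ZMod 2) = ∑ j ∈ Finset.Icc s t, bit α j := by
  simp [wtRange]

/-- Modulo 2 the halved indices cancel, and the extra last-bit terms contribute $1$ exactly for odd
`i`. -/
theorem theta_add_theta {m : ℕ} {α β : BVec m} (hα : bit α (2 * m) = 0)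
    (hβ : bit β (2 * m) = 1) (i : ℕ) :
    (theta α i : ZMod 2) + theta β i = ∑ j ∈ Finset.Icc i (2 * m), (bit α j + bit β j) + i := by
  have h2 : ∀ a : ZMod 2, a + a = 0 := CharTwo.add_self_eq_zero
  rw [Finset.sum_add_distrib]
  unfold theta
  split_ifs with h
  · rw [(ZMod.natCast_eq_zero_iff_even (n := i)).mpr h]
    push_cast [cast_wtRange]
    linear_combination h2 ((i / 2 : ℕ) : ZMod 2)
  · rw [(ZMod.natCast_eq_one_iff_odd (n := i)).mpr (Nat.not_even_iff_odd.mp h), hα, hβ]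
    have h1 : ((1 : ZMod 2).val : ZMod 2) = 1 := by decide
    push_cast [cast_wtRange, h1]
    simp only [ZMod.val_zero, Nat.cast_zero]
    linear_combination h2 (((i - 1) / 2 : ℕ) : ZMod 2)

/-- The sign relation of the Alamouti blocks of the explicit design. -/
theorem theta_block {m : ℕ} {α β : BVec m} {x y : ℕ} (hxy : x ≠ y) (hx : x < 2 * m)
    (hy : y < 2 * m) (hα : bit α (2 * m) = 0) (hβ : bit β (2 * m) = 1)
    (hαx : bit α x = 1) (hαy : bit α y = 1) (hβx : bit β x = 1) (hβy : bit β y = 1)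
    (h : ∀ j, 1 ≤ j → j ≤ 2 * m → j ≠ x → j ≠ y → bit α j + bit β j = 1) :
    (theta α x : ZMod 2) + theta β x + (theta α y + theta β y) = 1 := by
  have hx1 : 1 ≤ x := by
    by_contra hc
    rw [bit, dif_neg (by omega)] at hαx
    exact absurd hαx (by decide)
  have hy1 : 1 ≤ y := by
    by_contra hc
    rw [bit, dif_neg (by omega)] at hαy
    exact absurd hαy (by decide)
  have key : ∀ s, 1 ≤ s → s ≤ 2 * m → ∑ j ∈ Finset.Icc s (2 * m), (bit α j + bit β j) =
      ((2 * m + 1 - s : ℕ) : ZMod 2) + (if s ≤ x then 1 else 0) + (if s ≤ y then 1 else 0) := by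
    intro s hs _
    have h1 : ∀ j ∈ Finset.Icc s (2 * m), bit α j + bit β j =
        1 + (if j = x then 1 else 0) + (if j = y then 1 else 0) := by
      intro j hj
      rw [Finset.mem_Icc] at hj
      by_cases h1 : j = x
      · subst h1; rw [hαx, hβx, if_pos rfl, if_neg hxy, add_zero]
      · by_cases h2 : j = y
        · subst h2; rw [hαy, hβy, if_pos rfl, if_neg h1, add_zero]
        · rw [h j (by omega) hj.2 h1 h2, if_neg h1, if_neg h2, add_zero, add_zero]
    rw [Finset.sum_congr rfl h1, Finset.sum_add_distrib, Finset.sum_add_distrib,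
      Finset.sum_ite_eq', Finset.sum_ite_eq', Finset.sum_const, Nat.card_Icc]
    simp only [Finset.mem_Icc, hx.le, hy.le, and_true, nsmul_eq_mul, mul_one]
  rw [theta_add_theta hα hβ, theta_add_theta hα hβ, key x hx1 hx.le, key y hy1 hy.le]
  have e : ∀ s ≤ 2 * m, ((2 * m + 1 - s : ℕ) : ZMod 2) = 1 + s := by
    intro s hs
    rw [← CharTwo.sub_eq_add, Nat.cast_sub (by omega)]
    push_cast
    rw [show (2 : ZMod 2) = 0 from rfl, zero_mul, zero_add]
  rw [e x hx.le, e y hy.le]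
  have h2 : ∀ a : ZMod 2, a + a = 0 := CharTwo.add_self_eq_zero
  -- Exactly one of the two inequalities holds, since `x ≠ y`; this supplies the sign $-1$ of the
  -- block.
  have hc : (if x ≤ y then (1 : ZMod 2) else 0) + (if y ≤ x then 1 else 0) = 1 := by
    split_ifs <;> first | omega | simp
  simp only [le_refl, if_true]
  linear_combination hc + h2 (x : ZMod 2) + h2 (y : ZMod 2) + 2 * h2 1

/-! ### Composite transformations -/

/-- Negate and conjugate an entry as prescribed by `μ` (negation), `ν` (negation of instances) and
`κ` (conjugation of instances), then rename the variables by `ρ`. -/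
def Entry.twist {ι κ' : Type} (μ : Bool) (ν κ : ι → Bool) (ρ : ι → κ') : Entry ι → Entry κ'
  | zero => zero
  | var s c i => var (s ^^ ν i ^^ μ) (c ^^ κ i) (ρ i)

theorem Transforms.mono {p n k : ℕ} {S T : Set (Op p n k)} (h : S ⊆ T) {A B : Design p n k}
    (hAB : Transforms S A B) : Transforms T A B :=
  Relation.ReflTransGen.mono (fun _ _ ⟨op, ho, e⟩ => ⟨op, h ho, e⟩) A B hAB

section

variable {p n k : ℕ} (A : Design p n k)

variable {A} in
theorem transforms_step {B : Design p n k} (op : Op p n k) (h : ∀ c, op ≠ Op.columnNegation c)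
    (hB : B = op.apply A) : Transforms (withoutColumnNegation p n k) A B :=
  Relation.ReflTransGen.single ⟨op, h, hB⟩

variable {A} in
theorem transforms_of_eq {S : Set (Op p n k)} {B : Design p n k} (h : B = A) :
    Transforms S A B := by
  rw [h]; exact Relation.ReflTransGen.refl

theorem transforms_conj (T : Finset (Fin k)) :
    Transforms (withoutColumnNegation p n k) A
      (fun r c => (A r c).twist false (fun _ => false) (fun i => decide (i ∈ T)) id) := by
  induction T using Finset.induction_on with
  | empty =>
    refine transforms_of_eq ?_
    funext r c
    cases A r c <;> simp [Entry.twist]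
  | insert j T hj ih =>
    refine ih.trans (transforms_step (Op.instanceConjugation j) (by simp) ?_)
    funext r c
    simp only [Op.apply]
    rcases A r c with _ | ⟨s, b, i⟩
    · rfl
    · by_cases h : i = j
      · subst h; simp [Entry.twist, Entry.conjVar, hj]
      · simp [Entry.twist, Entry.conjVar, h]

theorem transforms_neg (T : Finset (Fin k)) :
    Transforms (withoutColumnNegation p n k) A
      (fun r c => (A r c).twist false (fun i => decide (i ∈ T)) (fun _ => false) id) := by
  induction T using Finset.induction_on with
  | empty =>
    refine transforms_of_eq ?_
    funext r c
    cases A r c <;> simp [Entry.twist]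
  | insert j T hj ih =>
    refine ih.trans (transforms_step (Op.instanceNegation j) (by simp) ?_)
    funext r c
    simp only [Op.apply]
    rcases A r c with _ | ⟨s, b, i⟩
    · rfl
    · by_cases h : i = j
      · subst h; simp [Entry.twist, Entry.negVar, hj]
      · simp [Entry.twist, Entry.negVar, h]

theorem transforms_rowNeg (T : Finset (Fin p)) :
    Transforms (withoutColumnNegation p n k) A
      (fun r c => (A r c).twist (decide (r ∈ T)) (fun _ => false) (fun _ => false) id) := by
  induction T using Finset.induction_on with
  | empty =>
    refine transforms_of_eq ?_
    funext r c
    cases A r c <;> simp [Entry.twist]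
  | insert j T hj ih =>
    refine ih.trans (transforms_step (Op.rowNegation j) (by simp) ?_)
    funext r c
    simp only [Op.apply]
    rcases A r c with _ | ⟨s, b, i⟩
    · simp [Entry.twist, Entry.neg]
    · by_cases h : r = j
      · subst h; simp [Entry.twist, Entry.neg, hj]
      · simp [Entry.twist, h]

/-- A row permutation, negations of rows, negations and conjugations of instances and a renaming
can be performed without column negations. -/
theorem transforms_twist (σ : Equiv.Perm (Fin p)) (ρ : Equiv.Perm (Fin k)) (μ : Fin p → Bool)
    (ν κ : Fin k → Bool) :
    Transforms (withoutColumnNegation p n k) A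
      (fun r c => (A (σ r) c).twist (μ r) ν κ ρ) := by
  -- Permuting rows first makes `μ` refer to new rows; renaming last lets `ν` and `κ` refer to old
  -- variables.
  refine (transforms_step (Op.rowPermutation σ) (by simp) rfl).trans ?_
  refine (transforms_conj _ (Finset.univ.filter (κ · = true))).trans ?_
  refine (transforms_neg _ (Finset.univ.filter (ν · = true))).trans ?_
  refine (transforms_rowNeg _ (Finset.univ.filter (μ · = true))).trans ?_
  refine transforms_step (Op.instanceRenaming ρ) (by simp) ?_
  funext r c
  simp only [Op.apply]
  rcases A (σ r) c with _ | ⟨s, b, i⟩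
  · rfl
  · simp [Entry.twist, Entry.rename]

end

namespace Pattern

variable {p k m : ℕ} {O : Design p (2 * m - 1) k} (P : Pattern O)

/-! ### Matching with the explicit design -/

/-- The row index with the same nonzero columns as the row `r`. -/
noncomputable def rowIdx (hm : 1 ≤ m) (hp : (m + 1) * p = 2 * m * k) (r : Fin p) : RowIdx m :=
  ⟨toBVec (supp O r) (if (supp O r).card = m then 1 else 0), by
    rw [wt_toBVec hm]
    rcases (P.tight hm hp).2.2 r with h | h
    · rw [if_pos h, h]; rfl
    · rw [if_neg (by omega), h]; rfl⟩

/-- The variable index corresponding to the type of the variable `i`. -/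
noncomputable def varIdx (hm : 1 ≤ m) (hp : (m + 1) * p = 2 * m * k) (i : Fin k) : VarIdx m :=
  ⟨toBVec (P.type i) 0, by
    rw [wt_toBVec hm, P.card_type hm hp, bit_toBVec_last hm]
    exact ⟨rfl, rfl⟩⟩

theorem bit_rowIdx_last (hm : 1 ≤ m) (hp : (m + 1) * p = 2 * m * k) (c : Fin (2 * m - 1))
    (i : Fin k) :
    bit (P.rowIdx hm hp (P.row c i)).1 (2 * m) = if c ∈ P.type i then 1 else 0 := by
  rw [rowIdx, bit_toBVec_last hm]
  simp only [P.mem_type_iff_card hm hp]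

theorem bit_rowIdx (hm : 1 ≤ m) (hp : (m + 1) * p = 2 * m * k) (r : Fin p)
    (c : Fin (2 * m - 1)) :
    bit (P.rowIdx hm hp r).1 ((c : ℕ) + 1) = if c ∈ supp O r then 1 else 0 :=
  bit_toBVec _ _ _

theorem rowIdx_bijective (hm : 1 ≤ m) (hp : (m + 1) * p = 2 * m * k)
    (hk : k = (2 * m - 1).choose m) (hpc : p = (2 * m).choose (m - 1)) :
    Function.Bijective (P.rowIdx hm hp) := by
  refine (Fintype.bijective_iff_injective_and_card _).mpr ⟨fun r r' h => ?_, ?_⟩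
  · exact P.supp_injective hm hp hk (toBVec_injective (congrArg Subtype.val h))
  · rw [card_rowIdx m hm, Fintype.card_fin, hpc]

theorem varIdx_bijective (hm : 1 ≤ m) (hp : (m + 1) * p = 2 * m * k)
    (hk : k = (2 * m - 1).choose m) : Function.Bijective (P.varIdx hm hp) := by
  refine (Fintype.bijective_iff_injective_and_card _).mpr ⟨fun i j h => ?_, ?_⟩
  · exact P.type_injective hm hp hk (toBVec_injective (congrArg Subtype.val h))
  · rw [card_varIdx m hm, Fintype.card_fin, hk]
    exact Nat.choose_symm_of_eq_add (by omega)

theorem explicitEntry_of_notMem (hm : 1 ≤ m) (hp : (m + 1) * p = 2 * m * k) {r : Fin p}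
    {c : Fin (2 * m - 1)} (h : c ∉ supp O r) :
    explicitEntry m (P.rowIdx hm hp r) c = Entry.zero := by
  have h1 := P.bit_rowIdx hm hp r c
  rw [if_neg h] at h1
  rw [explicitEntry, dif_neg (by rw [h1]; decide)]

theorem bit_unitVec_column (c d : Fin (2 * m - 1)) :
    bit (unitVec ((c : ℕ) + 1) : BVec m) ((d : ℕ) + 1) = if d = c then 1 else 0 := by
  have := d.isLt
  rw [bit_succ _ ⟨d, by omega⟩]
  simp [unitVec, Fin.ext_iff]

/-- For `c` in the type, the row support without `c` is the complement of the type, and adding the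
all-one vector turns it into the type; otherwise removing `c` from the support already gives the
type. -/
theorem explicitEntry_row (hm : 1 ≤ m) (hp : (m + 1) * p = 2 * m * k) (c : Fin (2 * m - 1))
    (i : Fin k) :
    explicitEntry m (P.rowIdx hm hp (P.row c i)) c =
      Entry.var (decide (Odd (theta (P.rowIdx hm hp (P.row c i)).1 ((c : ℕ) + 1))))
        (decide (c ∈ P.type i)) (P.varIdx hm hp i) := by
  have hc := c.isLt
  have h1 := P.bit_rowIdx hm hp (P.row c i) c
  rw [if_pos (P.row_mem_supp c i)] at h1
  have h2 := P.bit_rowIdx_last hm hp c i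
  rw [explicitEntry, dif_pos h1]
  by_cases h : c ∈ P.type i
  · rw [if_pos h] at h2
    rw [dif_neg (by rw [h2]; decide)]
    simp only [h, decide_true]
    congr 1
    refine Subtype.ext (bvec_ext (fun d => ?_) ?_)
    · have hd := d.isLt
      simp only [varIdx]
      rw [bit_add, bit_add, bit_rowIdx, bit_unitVec_column, bit_onesVec (by omega) (by omega),
        bit_toBVec, P.supp_row hm hp, if_pos h]
      by_cases hdc : d = c
      · subst hdc; simp [h]; decide
      · by_cases hd : d ∈ P.type i <;> simp [hdc, hd]; decide
    · simp only [varIdx]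
      rw [bit_add, bit_add, h2, bit_unitVec_ne (by omega), bit_onesVec (by omega) le_rfl,
        bit_toBVec_last hm]
      decide
  · rw [if_neg h] at h2
    rw [dif_pos h2]
    simp only [h, decide_false]
    congr 1
    refine Subtype.ext (bvec_ext (fun d => ?_) ?_)
    · simp only [varIdx]
      rw [bit_add, bit_rowIdx, bit_unitVec_column, bit_toBVec, P.supp_row hm hp, if_neg h]
      by_cases hdc : d = c
      · subst hdc; simp [h]; decide
      · by_cases hd : d ∈ P.type i <;> simp [hdc, hd]
    · simp only [varIdx]
      rw [bit_add, h2, bit_unitVec_ne (by omega), bit_toBVec_last hm, add_zero]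

theorem odd_eq_xor (b : Bool) (t : ℕ) (u v : ZMod 2)
    (h : (if b then 1 else 0) + (t : ZMod 2) = u + v) :
    decide (Odd t) = (b ^^ decide (u = 1) ^^ decide (v = 1)) := by
  simp only [← ZMod.natCast_eq_one_iff_odd]
  revert h
  generalize (t : ZMod 2) = w
  revert b u v w
  decide

theorem sign_sum (a b c d : Bool) (h : (a ^^ b ^^ c ^^ d) = true) :
    (if a then (1 : ZMod 2) else 0) + (if b then 1 else 0) + (if c then 1 else 0) +
      (if d then 1 else 0) = 1 := by
  revert a b c d
  decide

/-- The signs of a design with the given parameters differ from those of the explicit design by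
negations of rows and variables. -/
theorem exists_signs (hm : 1 ≤ m) (hp : (m + 1) * p = 2 * m * k)
    (hk : k = (2 * m - 1).choose m) :
    ∃ (μ : Fin p → Bool) (ν : Fin k → Bool), ∀ c i,
      decide (Odd (theta (P.rowIdx hm hp (P.row c i)).1 ((c : ℕ) + 1))) =
        (P.neg c i ^^ ν i ^^ μ (P.row c i)) := by
  obtain ⟨μ, ν, h⟩ := P.exists_sign_split hm hp hk
    -- The ratio of the two sign patterns: each has sum $1$ over a block, so the ratio has sum $0$.
    (fun c i => (if P.neg c i then 1 else 0) +
      (theta (P.rowIdx hm hp (P.row c i)).1 ((c : ℕ) + 1) : ZMod 2)) (by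
    intro x y i j S hxy hx hy hi hj h1 h2
    have hs := sign_sum _ _ _ _ (P.exchange x y i j hxy h1).2.2.2
    have hxi : x ∈ P.type i := by rw [hi]; exact Finset.mem_insert_self _ _
    have hxj : x ∉ P.type j := by simp [hj, hxy, hx]
    have hα := P.bit_rowIdx_last hm hp x j
    have hβ := P.bit_rowIdx_last hm hp x i
    rw [if_neg hxj] at hα
    rw [if_pos hxi] at hβ
    have sα : supp O (P.row x j) = insert x (insert y S) := by
      rw [P.supp_row hm hp, if_neg hxj, hj]
    have sβ : supp O (P.row x i) = Sᶜ := by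
      rw [P.supp_row hm hp, if_pos hxi, hi, Finset.compl_insert,
        Finset.insert_erase (by simpa using hx)]
    have hb := theta_block (x := (x : ℕ) + 1) (y := (y : ℕ) + 1) (by omega) (by omega) (by omega)
      hα hβ (by rw [bit_rowIdx, sα]; simp) (by rw [bit_rowIdx, sα]; simp)
      (by rw [bit_rowIdx, sβ]; simp [hx]) (by rw [bit_rowIdx, sβ]; simp [hy])
      (by
        intro l hl1 hl2 hlx hly
        by_cases hl : l = 2 * m
        · rw [hl, hα, hβ, zero_add]
        · obtain ⟨d, rfl⟩ : ∃ d : Fin (2 * m - 1), l = (d : ℕ) + 1 :=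
            ⟨⟨l - 1, by omega⟩, by simp only; omega⟩
          have hdx : d ≠ x := fun h => hlx (by rw [h])
          have hdy : d ≠ y := fun h => hly (by rw [h])
          rw [bit_rowIdx, bit_rowIdx, sα, sβ]
          by_cases hd : d ∈ S <;> simp [hd, hdx, hdy])
    rw [← h1, ← h2]
    rw [← sub_eq_zero, CharTwo.sub_eq_add]
    have two : (1 : ZMod 2) + 1 = 0 := by decide
    linear_combination hs + hb + two)
  exact ⟨fun r => decide (μ r = 1), fun i => decide (ν i = 1), fun c i =>
    odd_eq_xor _ _ _ _ (h c i)⟩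

end Pattern

/-- The rate identity that makes `Pattern.tight` applicable to the given parameters. -/
theorem rate_eq (m : ℕ) (hm : 1 ≤ m) :
    (m + 1) * (2 * m).choose (m - 1) = 2 * m * (2 * m - 1).choose (m - 1) := by
  obtain ⟨q, rfl⟩ : ∃ q, m = q + 1 := ⟨m - 1, by omega⟩
  have h := Nat.add_one_mul_choose_eq (2 * q + 1) (q + 1)
  have h1 : (2 * (q + 1)).choose (q + 1 - 1) = (2 * (q + 1)).choose (q + 1 + 1) :=
    Nat.choose_symm_of_eq_add (by omega)
  have h2 : (2 * (q + 1) - 1).choose (q + 1 - 1) = (2 * q + 1).choose (q + 1) :=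
    Nat.choose_symm_of_eq_add (by omega)
  have e : 2 * (q + 1) = 2 * q + 1 + 1 := by ring
  rw [h1, h2, e, h, mul_comm]

end COD

theorem mainTheorem2 (m : ℕ) (hm : 1 ≤ m)
    (O : COD.Design ((2 * m).choose (m - 1)) (2 * m - 1) ((2 * m - 1).choose (m - 1)))
    (hO : COD.IsCOD O) :
    COD.Equivalent O (COD.explicitDesign m hm) ∧
      COD.Transforms
        (COD.withoutColumnNegation
          ((2 * m).choose (m - 1)) (2 * m - 1) ((2 * m - 1).choose (m - 1)))
        O (COD.explicitDesign m hm) := by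
  suffices h : COD.Transforms (COD.withoutColumnNegation
      ((2 * m).choose (m - 1)) (2 * m - 1) ((2 * m - 1).choose (m - 1)))
      O (COD.explicitDesign m hm) from ⟨h.mono (Set.subset_univ _), h⟩
  obtain ⟨P⟩ := hO.nonempty_pattern
  have hp := COD.rate_eq m hm
  have hk : (2 * m - 1).choose (m - 1) = (2 * m - 1).choose m :=
    Nat.choose_symm_of_eq_add (by omega)
  obtain ⟨μ, ν, hs⟩ := P.exists_signs hm hp hk
  let R := Equiv.ofBijective _ (P.rowIdx_bijective hm hp hk rfl)
  let V := Equiv.ofBijective _ (P.varIdx_bijective hm hp hk)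
  let σ : Equiv.Perm (Fin ((2 * m).choose (m - 1))) := (COD.rowNumbering m hm).symm.trans R.symm
  have ht := COD.transforms_twist O σ (V.trans (COD.varNumbering m hm)) (fun r => μ (σ r)) ν P.flip
  refine ht.trans (COD.transforms_of_eq ?_)
  funext r c
  have hr : (COD.rowNumbering m hm).symm r = P.rowIdx hm hp (σ r) :=
    (R.apply_symm_apply _).symm
  rw [COD.explicitDesign, hr]
  generalize σ r = r'
  by_cases hc : c ∈ COD.supp O r'
  · obtain ⟨i, rfl⟩ := P.mem_supp.mp hc
    rw [P.explicitEntry_row hm hp, P.entry, hs]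
    simp only [COD.Entry.twist, COD.Entry.rename, COD.Entry.var.injEq, true_and]
    simp only [P.mem_type, Bool.decide_eq_true]
    exact ⟨trivial, rfl⟩
  · rw [P.explicitEntry_of_notMem hm hp hc]
    have : O r' c = COD.Entry.zero := by simpa [COD.supp] using hc
    rw [this]
    rfl
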